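/- Let $\tilde{\mathcal A}$ be the $\mathbb C$-algebra of formal sums $\sum_{\nu\ge 0}P_\nu(a)\,b^\nu$ with $P_\nu\in\mathbb C[z]$, in which $ab-ba=b^2$ and left and right multiplication by $a$ are continuous for the $b$-adic topology. An element is homogeneous of degree $n$ in $(a,b)$ if it is a $\mathbb C$-linear combination of the $a^jb^{n-j}$, $0\le j\le n$, and it is then monic in $a$ if the coefficient of $a^n$ is $1$. Every $x\in\tilde{\mathcal A}$ decomposes into homogeneous components; the valuation of $x\neq 0$ is the least degree of a non-zero component, and the initial form $\mathrm{in}(x)$ is that component (the valuation of $0$ is $+\infty$). An (a,b)-module is a left $\tilde{\mathcal A}$-module that is free of finite type over $\mathbb C[[b]]$; its rank is its rank over $\mathbb C[[b]]$. It has a simple pole if $aE\subset bE$, and it is regular if it embeds $\tilde{\mathcal A}$-linearly in an (a,b)-module with a simple pole. It is monogenic if it is isomorphic to $\tilde{\mathcal A}/I$ for some left ideal $I$. For $E$ a regular monogenic (a,b)-module of rank $k$, the Bernstein element of $E$ is the unique element $P\in\tilde{\mathcal A}$, homogeneous of degree $k$ in $(a,b)$ and monic in $a$, such that $E\simeq\tilde{\mathcal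 A}/\tilde{\mathcal A}(P+b^2R)$ for some $R\in\tilde{\mathcal A}$ which is a polynomial in $a$ of degree at most $k-1$ with coefficients in $\mathbb C[[b]]$ and has valuation at least $k-1$ in $(a,b)$. Theorem. Let $E$ be a regular (a,b)-module, let $k\ge 0$ be an integer, and let $e\in E$ be an element with $x e=0$ for some $x\in\tilde{\mathcal A}$ whose initial form in $(a,b)$ is monic in $a$ of degree $k$. Suppose that $F:=\tilde{\mathcal A}e$ has rank at least $k$. Then the (a,b)-module $F$ is regular, monogenic and of rank exactly $k$, and it has a unique Bernstein element, namely the initial form $\mathrm{in}(x)$ of $x$. -/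

import Mathlib

namespace AB

open Polynomial Finset

section Coefficients

/-- The integer `(-1)^j * C(m + j - 1, j)` (equal to `1` for `j = 0`), i.e. the coefficient in
`b^m * Q(a) = ∑ j, (-1)^j * C(m + j - 1, j) * Q^(j)(a) * b^(m + j)`, which is the form that the
relation `a * b - b * a = b^2` takes for the normally ordered monomials `a^i * b^m`. -/
def cf (m j : ℕ) : ℤ := (-1) ^ j * (Nat.multichoose m j : ℤ)

theorem cf_zero_right (m : ℕ) : cf m 0 = 1 := by simp [cf, Nat.multichoose_zero_right]
theorem cf_zero_left (j : ℕ) : cf 0 j = if j = 0 then 1 else 0 := by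
  cases j <;> simp [cf]

theorem cf_eq (m j : ℕ) : cf m j = Ring.choose (-(m : ℤ)) j := by
  rw [Ring.choose_neg, cf, Nat.multichoose_eq]
  rcases Nat.eq_zero_or_pos (m + j) with h | h
  · obtain ⟨rfl, rfl⟩ : m = 0 ∧ j = 0 := by omega
    simp
  · have : (m : ℤ) + j - 1 = ((m + j - 1 : ℕ) : ℤ) := by omega
    rw [this, Ring.choose_natCast]
    simp [Int.negOnePow, Units.smul_def]

theorem cf_add (m l j : ℕ) :
    cf (m + l) j = ∑ s ∈ antidiagonal j, cf m s.1 * cf l s.2 := by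
  simp only [cf_eq]
  push_cast
  rw [neg_add, Ring.add_choose_eq _ (Commute.all _ _)]

theorem cf_mul (m i s : ℕ) :
    cf m i * cf (m + i) s = cf m (i + s) * ((i + s).choose i : ℤ) := by
  have key : m.multichoose i * (m + i).multichoose s = m.multichoose (i + s) * (i + s).choose i := by
    have h := Nat.ascFactorial_mul_ascFactorial m i s
    have e : ∀ a b : ℕ, a.multichoose b * b.factorial = a.ascFactorial b := fun a b => by
      rw [Nat.multichoose_eq, Nat.ascFactorial_eq_factorial_mul_choose', mul_comm]
    rw [← e, ← e, ← e] at h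
    have h2 := Nat.add_choose_mul_factorial_mul_factorial i s
    have : 0 < i.factorial * s.factorial := by positivity
    apply Nat.eq_of_mul_eq_mul_right this
    calc _ = m.multichoose i * i.factorial * ((m+i).multichoose s * s.factorial) := by ring
      _ = _ := by rw [h, ← h2, Nat.choose_symm_add]; ring
  simp only [cf]
  have key' := congrArg (fun n : ℕ => (n : ℤ)) key
  push_cast at key'
  rw [pow_add]
  linear_combination (-1) ^ i * (-1) ^ s * key'

theorem iter_mul (p : ℕ) (u v : ℂ[X]) : derivative^[p] (u * v) =
    ∑ r ∈ antidiagonal p, ((p.choose r.1 : ℕ) : ℤ) • (derivative^[r.1] u * derivative^[r.2] v) := by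
  rw [Polynomial.iterate_derivative_mul, Nat.sum_antidiagonal_eq_sum_range_succ_mk]
  rw [← Finset.sum_range_reflect]
  refine Finset.sum_congr rfl fun k hk => ?_
  simp only [Finset.mem_range] at hk
  have h1 : p - (p.succ - 1 - k) = k := by omega
  have h2 : p.succ - 1 - k = p - k := by omega
  rw [h1, h2, Nat.choose_symm (by omega)]
  simp

/-- The `N`-th coefficient of the product of `∑ x m (a) * b^m` and `∑ y n (a) * b^n`: the sum over
`m + j + n = N` of `(-1)^j * C(m + j - 1, j) * x m * (y n)^(j)`. -/
noncomputable def mc (x y : ℕ → ℂ[X]) (N : ℕ) : ℂ[X] :=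
  ∑ p ∈ antidiagonal N, ∑ q ∈ antidiagonal p.1, cf q.1 q.2 • (x q.1 * derivative^[q.2] (y p.2))

theorem mc_assoc (x y z : ℕ → ℂ[X]) (N : ℕ) : mc (mc x y) z N = mc x (mc y z) N := by
  have L : mc (mc x y) z N = ∑ p ∈ antidiagonal N, ∑ q ∈ antidiagonal p.1,
      ∑ p' ∈ antidiagonal q.1, ∑ q' ∈ antidiagonal p'.1, ∑ s ∈ antidiagonal q.2,
      (cf q'.1 (q'.2 + s.1) * ((q'.2 + s.1).choose q'.2 : ℤ) * cf p'.2 s.2) •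
      (x q'.1 * (derivative^[q'.2] (y p'.2) * derivative^[s.1 + s.2] (z p.2))) := by
    unfold mc
    refine sum_congr rfl fun p hp => sum_congr rfl fun q hq => ?_
    rw [sum_mul, smul_sum]
    refine sum_congr rfl fun p' hp' => ?_
    rw [sum_mul, smul_sum]
    refine sum_congr rfl fun q' hq' => ?_
    simp only [HasAntidiagonal.mem_antidiagonal] at hp hq hp' hq'
    have : q.1 = q'.1 + q'.2 + p'.2 := by omega
    rw [this, cf_add, sum_smul]
    refine sum_congr rfl fun s hs => ?_
    simp only [HasAntidiagonal.mem_antidiagonal] at hs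
    rw [← cf_mul, hs, smul_mul_assoc, smul_smul]
    congr 1
    · ring
    · ring
  have R : mc x (mc y z) N = ∑ p ∈ antidiagonal N, ∑ q ∈ antidiagonal p.1,
      ∑ p' ∈ antidiagonal p.2, ∑ q' ∈ antidiagonal p'.1, ∑ s ∈ antidiagonal q.2,
      (cf q.1 (s.1 + s.2) * ((s.1 + s.2).choose s.1 : ℤ) * cf q'.1 q'.2) •
      (x q.1 * (derivative^[s.1] (y q'.1) * derivative^[s.2 + q'.2] (z p'.2))) := by
    unfold mc
    refine sum_congr rfl fun p hp => sum_congr rfl fun q hq => ?_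
    rw [iterate_derivative_sum, mul_sum, smul_sum]
    refine sum_congr rfl fun p' hp' => ?_
    rw [iterate_derivative_sum, mul_sum, smul_sum]
    refine sum_congr rfl fun q' hq' => ?_
    rw [iterate_derivative_smul, iter_mul, smul_sum, mul_sum, smul_sum]
    refine sum_congr rfl fun s hs => ?_
    simp only [HasAntidiagonal.mem_antidiagonal] at hs
    rw [← hs, Function.iterate_add_apply, mul_smul_comm, mul_smul_comm, smul_smul, smul_smul]
    congr 1
    ring
  rw [L, R]
  simp only [sum_sigma']
  refine sum_nbij'
    (fun t => ⟨(t.2.2.2.1.1 + (t.2.2.2.1.2 + t.2.2.2.2.1), t.2.2.1.2 + t.2.2.2.2.2 + t.1.2),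
      (t.2.2.2.1.1, t.2.2.2.1.2 + t.2.2.2.2.1), (t.2.2.1.2 + t.2.2.2.2.2, t.1.2),
      (t.2.2.1.2, t.2.2.2.2.2), (t.2.2.2.1.2, t.2.2.2.2.1)⟩)
    (fun t => ⟨(t.2.1.1 + t.2.2.2.2.1 + t.2.2.2.1.1 + (t.2.2.2.2.2 + t.2.2.2.1.2), t.2.2.1.2),
      (t.2.1.1 + t.2.2.2.2.1 + t.2.2.2.1.1, t.2.2.2.2.2 + t.2.2.2.1.2),
      (t.2.1.1 + t.2.2.2.2.1, t.2.2.2.1.1), (t.2.1.1, t.2.2.2.2.1),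
      (t.2.2.2.2.2, t.2.2.2.1.2)⟩) ?_ ?_ ?_ ?_ ?_
  · rintro ⟨⟨p1, p2⟩, ⟨q1, q2⟩, ⟨p1', p2'⟩, ⟨q1', q2'⟩, ⟨s1, s2⟩⟩ h
    simp only [mem_sigma, HasAntidiagonal.mem_antidiagonal] at h ⊢
    obtain ⟨h1, h2, h3, h4, h5⟩ := h
    refine ⟨?_, ?_, ?_, ?_, ?_⟩ <;> first | omega | simp
  · rintro ⟨⟨p1, p2⟩, ⟨q1, q2⟩, ⟨p1', p2'⟩, ⟨q1', q2'⟩, ⟨s1, s2⟩⟩ h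
    simp only [mem_sigma, HasAntidiagonal.mem_antidiagonal] at h ⊢
    obtain ⟨h1, h2, h3, h4, h5⟩ := h
    refine ⟨?_, ?_, ?_, ?_, ?_⟩ <;> first | omega | simp
  · rintro ⟨⟨p1, p2⟩, ⟨q1, q2⟩, ⟨p1', p2'⟩, ⟨q1', q2'⟩, ⟨s1, s2⟩⟩ h
    simp only [mem_sigma, HasAntidiagonal.mem_antidiagonal] at h ⊢
    obtain ⟨h1, h2, h3, h4, h5⟩ := h
    subst h5 h4 h3 h2
    rfl
  · rintro ⟨⟨p1, p2⟩, ⟨q1, q2⟩, ⟨p1', p2'⟩, ⟨q1', q2'⟩, ⟨s1, s2⟩⟩ h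
    simp only [mem_sigma, HasAntidiagonal.mem_antidiagonal] at h ⊢
    obtain ⟨h1, h2, h3, h4, h5⟩ := h
    subst h5 h4 h3 h2
    rfl
  · rintro ⟨⟨p1, p2⟩, ⟨q1, q2⟩, ⟨p1', p2'⟩, ⟨q1', q2'⟩, ⟨s1, s2⟩⟩ h
    rfl

theorem mc_of_const (x y : ℕ → ℂ[X]) (hy : ∀ n, derivative (y n) = 0) (N : ℕ) :
    mc x y N = ∑ p ∈ antidiagonal N, x p.1 * y p.2 := by
  refine sum_congr rfl fun p _ => ?_
  rw [sum_eq_single (p.1, 0)]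
  · simp [cf_zero_right]
  · rintro ⟨q1, q2⟩ hq hne
    simp only [HasAntidiagonal.mem_antidiagonal] at hq
    rcases q2 with _ | q2
    · exact absurd (by simpa using hq) (by simpa using hne)
    · simp [Function.iterate_succ_apply, hy]
  · simp

theorem mc_of_zero (x y : ℕ → ℂ[X]) (hx : ∀ n, n ≠ 0 → x n = 0) (N : ℕ) :
    mc x y N = x 0 * y N := by
  unfold mc
  rw [sum_eq_single (0, N)]
  · simp [cf_zero_right]
  · rintro ⟨p1, p2⟩ hp hne
    simp only [HasAntidiagonal.mem_antidiagonal] at hp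
    refine sum_eq_zero ?_
    rintro ⟨q1, q2⟩ hq
    simp only [HasAntidiagonal.mem_antidiagonal] at hq
    rcases Nat.eq_zero_or_pos q1 with h | h
    · subst h
      have : q2 ≠ 0 := by
        rintro rfl
        apply hne
        simp only [Prod.mk.injEq]
        omega
      simp [cf_zero_left, this]
    · simp [hx q1 (by omega)]
  · simp

end Coefficients

/-- The algebra `Ã` of formal sums `∑ P_ν(a) * b^ν` with `P_ν` a complex polynomial, subject to
`a * b - b * a = b^2`. The element `x` stands for `∑ ν, (x.coeff ν)(a) * b^ν`. -/
@[ext]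
structure ATilde : Type where
  coeff : ℕ → ℂ[X]

namespace ATilde

noncomputable instance : Zero ATilde := ⟨⟨fun _ => 0⟩⟩

noncomputable instance : Add ATilde := ⟨fun x y => ⟨fun ν => x.coeff ν + y.coeff ν⟩⟩

noncomputable instance : Neg ATilde := ⟨fun x => ⟨fun ν => -x.coeff ν⟩⟩

noncomputable instance : Sub ATilde := ⟨fun x y => ⟨fun ν => x.coeff ν - y.coeff ν⟩⟩

noncomputable instance : SMul ℕ ATilde := ⟨fun n x => ⟨fun ν => n • x.coeff ν⟩⟩

noncomputable instance : SMul ℤ ATilde := ⟨fun n x => ⟨fun ν => n • x.coeff ν⟩⟩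

noncomputable instance : SMul ℂ ATilde := ⟨fun c x => ⟨fun ν => c • x.coeff ν⟩⟩

theorem ext_coeff {x y : ATilde} (h : ∀ ν, x.coeff ν = y.coeff ν) : x = y :=
  ATilde.ext (funext h)

theorem coeff_injective : Function.Injective ATilde.coeff := fun _ _ h => ATilde.ext h

noncomputable instance : AddCommGroup ATilde :=
  coeff_injective.addCommGroup _ rfl (fun _ _ => rfl) (fun _ => rfl) (fun _ _ => rfl)
    (fun _ _ => rfl) (fun _ _ => rfl)

noncomputable instance : Module ℂ ATilde :=
  coeff_injective.module ℂ (⟨⟨ATilde.coeff, rfl⟩, fun _ _ => rfl⟩ : ATilde →+ (ℕ → ℂ[X]))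
    (fun _ _ => rfl)

theorem coeff_add (x y : ATilde) (ν : ℕ) : (x + y).coeff ν = x.coeff ν + y.coeff ν := rfl

theorem coeff_zero (ν : ℕ) : (0 : ATilde).coeff ν = 0 := rfl

theorem coeff_smul (c : ℂ) (x : ATilde) (ν : ℕ) : (c • x).coeff ν = c • x.coeff ν := rfl

/-- The element `P(a) * b^n`. -/
noncomputable def single (n : ℕ) (P : ℂ[X]) : ATilde := ⟨fun ν => if ν = n then P else 0⟩

noncomputable instance : Mul ATilde := ⟨fun x y => ⟨mc x.coeff y.coeff⟩⟩

noncomputable instance : One ATilde := ⟨single 0 1⟩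

theorem coeff_mul (x y : ATilde) (N : ℕ) : (x * y).coeff N = mc x.coeff y.coeff N := rfl

theorem one_def : (1 : ATilde) = single 0 1 := rfl

noncomputable instance : Ring ATilde :=
  { (inferInstance : AddCommGroup ATilde), (inferInstance : Mul ATilde),
    (inferInstance : One ATilde) with
    left_distrib := fun x y z => ext_coeff fun N => by
      simp only [coeff_mul, coeff_add, mc, iterate_map_add, mul_add, smul_add, sum_add_distrib]
    right_distrib := fun x y z => ext_coeff fun N => by
      simp only [coeff_mul, coeff_add, mc, add_mul, smul_add, sum_add_distrib]
    zero_mul := fun x => ext_coeff fun N => by simp [coeff_mul, coeff_zero, mc]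
    mul_zero := fun x => ext_coeff fun N => by
      simp [coeff_mul, coeff_zero, mc, iterate_map_zero]
    mul_assoc := fun x y z => ext_coeff fun N => mc_assoc x.coeff y.coeff z.coeff N
    one_mul := fun x => ext_coeff fun N => by
      rw [coeff_mul, mc_of_zero _ _ (fun n hn => by simp [one_def, single, hn])]
      simp [one_def, single]
    mul_one := fun x => ext_coeff fun N => by
      rw [coeff_mul, mc_of_const _ _ (fun n => by
        by_cases h : n = 0 <;> simp [one_def, single, h])]
      rw [sum_eq_single (N, 0)]
      · simp [one_def, single]
      · rintro ⟨p1, p2⟩ hp hne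
        simp only [HasAntidiagonal.mem_antidiagonal] at hp
        have : p2 ≠ 0 := by
          rintro rfl
          exact hne (by simpa using hp)
        simp [one_def, single, this]
      · simp
    zsmul := fun n x => n • x
    nsmul := fun n x => n • x
    zsmul_zero' := fun x => zero_zsmul x
    zsmul_succ' := fun n x => SubNegMonoid.zsmul_succ' n x
    zsmul_neg' := fun n x => SubNegMonoid.zsmul_neg' n x
    nsmul_zero := fun x => zero_nsmul x
    nsmul_succ := fun n x => succ_nsmul x n }

noncomputable instance : Algebra ℂ ATilde :=
  Algebra.ofModule
    (fun c x y => ext_coeff fun N => by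
      simp only [coeff_mul, coeff_smul, mc, smul_sum, smul_mul_assoc, smul_comm c])
    (fun c x y => ext_coeff fun N => by
      simp only [coeff_mul, coeff_smul, mc, smul_sum, iterate_derivative_smul, mul_smul_comm,
        smul_comm c])

/-- The generator `a`. -/
noncomputable def a : ATilde := single 0 X

/-- The generator `b`. -/
noncomputable def b : ATilde := single 1 1

theorem single_zero_mul_single (P Q : ℂ[X]) (n : ℕ) :
    single 0 P * single n Q = single n (P * Q) := ext_coeff fun N => by
  rw [coeff_mul, mc_of_zero _ _ (fun n hn => by simp [single, hn])]
  by_cases h : N = n <;> simp [single, h]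

theorem coeff_mul_b (x : ATilde) (N : ℕ) : (x * b).coeff (N + 1) = x.coeff N := by
  rw [coeff_mul, mc_of_const _ _ (fun n => by by_cases h : n = 1 <;> simp [b, single, h]),
    sum_eq_single (N, 1)]
  · simp [b, single]
  · rintro ⟨p1, p2⟩ hp hne
    simp only [HasAntidiagonal.mem_antidiagonal] at hp
    have : p2 ≠ 1 := by
      rintro rfl
      exact hne (by simpa using hp)
    simp [b, single, this]
  · simp

theorem coeff_mul_b_zero (x : ATilde) : (x * b).coeff 0 = 0 := by
  rw [coeff_mul, mc_of_const _ _ (fun n => by by_cases h : n = 1 <;> simp [b, single, h])]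
  simp [b, single]

theorem single_mul_b (P : ℂ[X]) (n : ℕ) : single n P * b = single (n + 1) P :=
  ext_coeff fun N => by
    rcases N with _ | N
    · simp [coeff_mul_b_zero, single]
    · simp [coeff_mul_b, single]

theorem a_pow_mul_b_pow (i n : ℕ) : a ^ i * b ^ n = single n (X ^ i) := by
  have ha : a ^ i = single 0 (X ^ i) := by
    induction i with
    | zero => simp [one_def]
    | succ i ih => rw [pow_succ, ih, a, single_zero_mul_single, pow_succ]
  induction n with
  | zero => simp [ha]
  | succ n ih => rw [pow_succ, ← mul_assoc, ih, single_mul_b]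

/-- The defining commutation relation of `Ã`. -/
theorem a_mul_b_sub_b_mul_a : a * b - b * a = b ^ 2 := by
  have h : b * a = a * b - b ^ 2 := by
    have h1 := a_pow_mul_b_pow 1 1
    have h2 := a_pow_mul_b_pow 0 2
    simp only [pow_one, pow_zero, one_mul] at h1 h2
    rw [eq_sub_iff_add_eq, h1, h2]
    refine ext_coeff fun N => ?_
    rw [coeff_add, coeff_mul]
    unfold mc
    rw [sum_eq_single (N, 0)]
    · rcases N with _ | _ | _ | N
      · simp [a, b, single, cf]
      · rw [sum_eq_single (1, 0)]
        · simp [a, b, single, cf]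
        · rintro ⟨q1, q2⟩ hq hne
          simp only [HasAntidiagonal.mem_antidiagonal] at hq
          have : q1 ≠ 1 := by
            rintro rfl
            exact hne (by simpa using by omega)
          simp [b, single, this]
        · simp
      · rw [sum_eq_single (1, 1)]
        · simp [a, b, single, cf]
        · rintro ⟨q1, q2⟩ hq hne
          simp only [HasAntidiagonal.mem_antidiagonal] at hq
          have : q1 ≠ 1 := by
            rintro rfl
            exact hne (by simpa using by omega)
          simp [b, single, this]
        · simp
      · rw [sum_eq_zero]
        · simp [single]
        · rintro ⟨q1, q2⟩ hq
          simp only [HasAntidiagonal.mem_antidiagonal] at hq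
          by_cases h1 : q1 = 1
          · obtain ⟨r, rfl⟩ : ∃ r, q2 = r + 2 := ⟨q2 - 2, by omega⟩
            simp [a, single, Function.iterate_add_apply]
          · simp [b, single, h1]
    · rintro ⟨p1, p2⟩ hp hne
      simp only [HasAntidiagonal.mem_antidiagonal] at hp
      have : p2 ≠ 0 := by
        rintro rfl
        exact hne (by simpa using hp)
      simp [a, single, this, iterate_map_zero]
    · simp
  rw [h, sub_sub_cancel]

/-- The inclusion of `ℂ[[b]]` in `Ã`. -/
noncomputable def ofPowerSeries : PowerSeries ℂ →+* ATilde where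
  toFun S := ⟨fun ν => C (PowerSeries.coeff ν S)⟩
  map_zero' := ext_coeff fun N => by simp [coeff_zero]
  map_one' := ext_coeff fun N => by
    by_cases h : N = 0 <;> simp [one_def, single, PowerSeries.coeff_one, h]
  map_add' S T := ext_coeff fun N => by simp [coeff_add]
  map_mul' S T := ext_coeff fun N => by
    rw [coeff_mul, mc_of_const _ _ (fun n => by simp)]
    simp [PowerSeries.coeff_mul, map_sum]

/-- `P` is homogeneous of degree `k` in `(a,b)` and monic in `a`. -/
def IsHomogeneousMonic (k : ℕ) (P : ATilde) : Prop :=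
  ∃ l : ℕ → ℂ, l k = 1 ∧ P = ∑ j ∈ range (k + 1), l j • (a ^ j * b ^ (k - j))

/-- The homogeneous component of degree `n` in `(a,b)`. -/
noncomputable def homPart (n : ℕ) (x : ATilde) : ATilde :=
  ∑ j ∈ range (n + 1), (x.coeff (n - j)).coeff j • (a ^ j * b ^ (n - j))

/-- The valuation in `(a,b)` of a non-zero element (`0` for the zero element). -/
noncomputable def valuation (x : ATilde) : ℕ := sInf {n | homPart n x ≠ 0}

/-- The initial form in `(a,b)`: the non-zero homogeneous component of least degree (`0` for the
zero element). -/
noncomputable def initialForm (x : ATilde) : ATilde := homPart (valuation x) x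

end ATilde

open ATilde

section Modules

universe u

variable (E : Type u) [AddCommGroup E] [Module ATilde E]

/-- The `ℂ[[b]]`-module underlying a left `Ã`-module. -/
noncomputable abbrev powerSeriesModule : Module (PowerSeries ℂ) E :=
  Module.compHom E ofPowerSeries

/-- An (a,b)-module: a left `Ã`-module that is free of finite type over `ℂ[[b]]`. -/
def IsABModule : Prop :=
  letI := powerSeriesModule E
  Module.Free (PowerSeries ℂ) E ∧ Module.Finite (PowerSeries ℂ) E

/-- The rank over `ℂ[[b]]`. -/
noncomputable def rank : ℕ :=
  letI := powerSeriesModule E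
  Module.finrank (PowerSeries ℂ) E

/-- An (a,b)-module has a simple pole when `a E ⊆ b E`. -/
def IsSimplePole : Prop :=
  IsABModule E ∧ ∀ f : E, ∃ g : E, a • f = b • g

/-- An (a,b)-module is regular when it embeds in an (a,b)-module with a simple pole. -/
def IsRegular : Prop :=
  IsABModule E ∧ ∃ (F : Type u) (_ : AddCommGroup F) (_ : Module ATilde F),
    IsSimplePole F ∧ ∃ φ : E →ₗ[ATilde] F, Function.Injective φ

/-- `E` is isomorphic to a quotient of `Ã` by a left ideal. -/
def IsMonogenic : Prop :=
  ∃ I : Ideal ATilde, Nonempty (E ≃ₗ[ATilde] ATilde ⧸ I)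

/-- `P` is a Bernstein element of `E`, of rank `k`: `E` is isomorphic to `Ã / Ã (P + b^2 R)`, where
`P` is homogeneous of degree `k` in `(a,b)` and monic in `a`, and `R` is a polynomial in `a` of
degree at most `k - 1` with coefficients in `ℂ[[b]]`, of valuation at least `k - 1` in `(a,b)`. -/
def IsBernsteinElement (P : ATilde) : Prop :=
  IsHomogeneousMonic (rank E) P ∧
  ∃ R : ATilde, (∀ ν, (R.coeff ν).degree < (rank E : ℕ)) ∧ (∀ m, m + 1 < rank E → homPart m R = 0) ∧
    Nonempty (E ≃ₗ[ATilde] ATilde ⧸ (Ideal.span {P + b ^ 2 * R} : Ideal ATilde))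

end Modules

end AB

namespace AB

open Polynomial Finset

namespace ATilde

/-! On the regular module `F = Ãe` some power `a ^ N` maps `F` into `bF`: inside a module with a
simple pole `a ^ n` lands in the image of `b ^ n`, and Artin–Rees brings this back to `F`
(`IsRegular.exists_a_pow_smul`). The part of `x` without `b` is `X ^ k * u` with `u(0) = 1`, so a
Bézout relation between `u` and `X ^ N` removes `u` and yields an annihilator of `e` equal to `a ^
k` modulo `b` (`exists_coeff_zero_eq_X_pow`).

Division by it (`exists_eq_mul_add`) shows that `e, ae, …, a ^ (k-1) e` generate `F` over `ℂ[[b]]`.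
As the rank is at least `k`, they form a basis, and the annihilator of `e` is principal
(`rank_eq_of_smul_eq_zero`). Its generator `y`, normalised to `a ^ k` minus terms of degree less
than `k` in `a`, satisfies `x = p * y` with `p` of constant term `1`. Hence `x` and `y` have the
same initial form `P`, and `y - P` is divisible by `b ^ 2` for degree reasons. Another generator of
`F` changes `y` to `y'` with `y' * u = w * y`, where `u` and `w` share a non-zero constant term;
comparing lowest-degree parts gives uniqueness (`initialForm_annihilator_unique`). -/

theorem coeff_sub (x y : ATilde) (ν : ℕ) : (x - y).coeff ν = x.coeff ν - y.coeff ν := rfl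

theorem coeff_sum {ι : Type*} (s : Finset ι) (f : ι → ATilde) (ν : ℕ) :
    (∑ i ∈ s, f i).coeff ν = ∑ i ∈ s, (f i).coeff ν :=
  map_sum (⟨⟨fun x : ATilde => x.coeff ν, rfl⟩, fun _ _ => rfl⟩ : ATilde →+ ℂ[X]) f s

theorem coeff_single (n : ℕ) (P : ℂ[X]) (ν : ℕ) :
    (single n P).coeff ν = if ν = n then P else 0 := rfl

/-! ### Left multiplication and left division by `b`. -/

theorem coeff_mul_zero (x y : ATilde) : (x * y).coeff 0 = x.coeff 0 * y.coeff 0 := by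
  simp [coeff_mul, mc, cf_zero_right]

theorem coeff_b_zero : b.coeff 0 = 0 := by simp [b, coeff_single]

theorem coeff_b_mul_zero (w : ATilde) : (b * w).coeff 0 = 0 := by
  simp [coeff_mul_zero, coeff_b_zero]

theorem a_pow_eq (i : ℕ) : a ^ i = single 0 (X ^ i) := by
  simpa using a_pow_mul_b_pow i 0

theorem cf_one_left (j : ℕ) : cf 1 j = (-1) ^ j := by simp [cf, Nat.multichoose_one]

theorem coeff_b_mul_succ_eq_sum (w : ATilde) (N : ℕ) : (b * w).coeff (N + 1) =
    ∑ p ∈ antidiagonal N, cf 1 p.1 • derivative^[p.1] (w.coeff p.2) := by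
  rw [coeff_mul, mc, Nat.sum_antidiagonal_succ]
  have h0 : ∀ q ∈ antidiagonal 0,
      cf q.1 q.2 • (b.coeff q.1 * derivative^[q.2] (w.coeff (N + 1))) = 0 := by
    simp [coeff_b_zero]
  simp only [sum_eq_zero h0, zero_add]
  refine sum_congr rfl fun p _ => ?_
  rw [sum_eq_single (1, p.1)]
  · simp [b, coeff_single]
  · rintro ⟨q1, q2⟩ hq hne
    simp only [HasAntidiagonal.mem_antidiagonal] at hq
    have : q1 ≠ 1 := fun h => hne (Prod.ext h (by change q2 = p.1; omega))
    simp [b, coeff_single, this]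
  · simp [add_comm]

/-- Left multiplication by `b`, coefficient by coefficient. -/
theorem coeff_b_mul_succ (w : ATilde) (N : ℕ) :
    (b * w).coeff (N + 1) = w.coeff N - derivative ((b * w).coeff N) := by
  rcases N with _ | N
  · simp [coeff_b_mul_succ_eq_sum, coeff_b_mul_zero, cf_zero_right]
  -- Since `cf 1 j = (-1) ^ j`, the sum for `N + 1` without its first term is minus the derivative
  -- of the sum for `N`.
  · rw [coeff_b_mul_succ_eq_sum, coeff_b_mul_succ_eq_sum, Nat.sum_antidiagonal_succ,
      derivative_sum]
    simp only [cf_one_left, pow_zero, Function.iterate_zero, id, one_smul, sub_eq_add_neg,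
      ← sum_neg_distrib]
    congr 1
    refine sum_congr rfl fun p _ => ?_
    rw [derivative_smul, Function.iterate_succ_apply', pow_succ, mul_neg_one, neg_smul]

/-- The element `y` with `b * y = x - P₀(a)`, where `P₀` is the coefficient of `b ^ 0` in `x`. -/
noncomputable def divB (x : ATilde) : ATilde :=
  ⟨fun N => x.coeff (N + 1) + if N = 0 then 0 else derivative (x.coeff N)⟩

/-- The recursion of `coeff_b_mul_succ` forces the formula for `divB`. The derivative is absent at
index `0` because `b * w` has zero coefficient there, whereas `x` need not. -/
theorem single_add_b_mul_divB (x : ATilde) : single 0 (x.coeff 0) + b * divB x = x := by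
  refine ext_coeff fun N => ?_
  rw [coeff_add, coeff_single]
  induction N with
  | zero => simp [coeff_b_mul_zero]
  | succ N ih =>
    rw [coeff_b_mul_succ]
    rcases N with _ | N
    · simp [divB, coeff_b_mul_zero]
    · simp only [Nat.add_eq_zero_iff, one_ne_zero, and_false, if_false, zero_add] at ih ⊢
      rw [ih]
      simp [divB]

theorem b_mul_divB {x : ATilde} (h : x.coeff 0 = 0) : b * divB x = x := by
  have := single_add_b_mul_divB x
  rw [h] at this
  rwa [show single 0 0 = 0 from ext_coeff fun N => by simp [coeff_single, coeff_zero],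
    zero_add] at this

/-! ### Degree in `a` and valuation in `(a,b)`. -/

/-- The elements that are polynomials in `a` of degree less than `k`. -/
def DegLT (k : ℕ) (x : ATilde) : Prop := ∀ ν, (x.coeff ν).degree < (k : ℕ)

theorem DegLT.divB {k : ℕ} {x : ATilde} (h : DegLT k x) : DegLT k (divB x) := by
  intro N
  refine (degree_add_le _ _).trans_lt (max_lt (h _) ?_)
  split_ifs
  · simp
  · exact (degree_derivative_le).trans_lt (h _)

/-- The elements of valuation at least `n` in `(a,b)`. -/
def ValGE (n : ℕ) (x : ATilde) : Prop := ∀ j ν, j + ν < n → (x.coeff ν).coeff j = 0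

theorem ValGE.add {n : ℕ} {x y : ATilde} (hx : ValGE n x) (hy : ValGE n y) :
    ValGE n (x + y) := fun j ν h => by simp [coeff_add, hx j ν h, hy j ν h]

theorem ValGE.sub {n : ℕ} {x y : ATilde} (hx : ValGE n x) (hy : ValGE n y) :
    ValGE n (x - y) := fun j ν h => by simp [coeff_sub, hx j ν h, hy j ν h]

theorem ValGE.mono {m n : ℕ} (h : m ≤ n) {x : ATilde} (hx : ValGE n x) : ValGE m x :=
  fun j ν hj => hx j ν (hj.trans_le h)

/-- The relation `ab - ba = b ^ 2` is homogeneous: each derivative in the product lowers the degree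
in `a` by one and raises the power of `b` by one. -/
theorem ValGE.mul {m n : ℕ} {x y : ATilde} (hx : ValGE m x) (hy : ValGE n y) :
    ValGE (m + n) (x * y) := by
  intro j N hj
  rw [coeff_mul, mc, finsetSum_coeff]
  refine sum_eq_zero fun p hp => ?_
  rw [finsetSum_coeff]
  refine sum_eq_zero fun q hq => ?_
  rw [Polynomial.coeff_smul, Polynomial.coeff_mul]
  refine smul_eq_zero_of_right _ (sum_eq_zero fun r hr => ?_)
  simp only [HasAntidiagonal.mem_antidiagonal] at hp hq hr
  by_cases h : r.1 + q.1 < m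
  · rw [hx _ _ h, zero_mul]
  · rw [coeff_iterate_derivative, hy (r.2 + q.2) p.2 (by omega), smul_zero, mul_zero]

theorem ValGE.divB {n : ℕ} {x : ATilde} (h : ValGE (n + 1) x) : ValGE n (divB x) := by
  intro j ν hj
  rcases ν with _ | ν
  · simp [ATilde.divB, h j 1 (by omega)]
  · simp [ATilde.divB, coeff_derivative, h j (ν + 1 + 1) (by omega),
      h (j + 1) (ν + 1) (by omega)]

theorem valGE_b : ValGE 1 b := by
  intro j ν h
  obtain ⟨rfl, rfl⟩ : j = 0 ∧ ν = 0 := by omega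
  simp [coeff_b_zero]

theorem valGE_zero (x : ATilde) : ValGE 0 x := fun _ _ h => absurd h (by omega)

/-! ### Division with remainder, and expansion over `ℂ[[b]]`. -/

/-- The quotient of the division of `z` by an element whose coefficient of `b ^ 0` is `X ^ k`. -/
noncomputable def quotCoeff (k : ℕ) (y z : ℕ → ℂ[X]) (N : ℕ) : ℂ[X] :=
  (z N - mc (fun m => if _h : m < N then quotCoeff k y z m else 0) y N) /ₘ X ^ k
termination_by N

/-- The coefficient `q N` meets only `y 0`, underived; the rest involves only `q m` with `m < N`.
This lets the quotient be found one coefficient at a time. -/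
theorem mc_eq_mul_add (q y : ℕ → ℂ[X]) (N : ℕ) :
    mc q y N = q N * y 0 + mc (fun m => if m < N then q m else 0) y N := by
  have h : mc (fun m => if m = N then q m else 0) y N = q N * y 0 := by
    unfold mc
    rw [sum_eq_single (N, 0), sum_eq_single (N, 0)]
    · simp [cf_zero_right]
    · rintro ⟨q1, q2⟩ hq hne
      simp only [HasAntidiagonal.mem_antidiagonal] at hq
      have : q1 ≠ N := fun h => hne (Prod.ext h (by change q2 = 0; omega))
      simp [this]
    · simp
    · rintro ⟨p1, p2⟩ hp hne
      simp only [HasAntidiagonal.mem_antidiagonal] at hp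
      refine sum_eq_zero fun r hr => ?_
      simp only [HasAntidiagonal.mem_antidiagonal] at hr
      have : r.1 ≠ N := by
        rintro h
        exact hne (by simp only [Prod.mk.injEq]; omega)
      simp [this]
    · simp
  rw [← h]
  simp only [mc, ← sum_add_distrib]
  refine sum_congr rfl fun p hp => sum_congr rfl fun r hr => ?_
  simp only [HasAntidiagonal.mem_antidiagonal] at hp hr
  rw [← smul_add, ← add_mul]
  congr 2
  rcases (show r.1 ≤ N by omega).lt_or_eq with h | h
  · simp [h, h.ne]
  · simp [h]

/-- Division by an element whose coefficient of `b ^ 0` is `a ^ k`. -/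
theorem exists_eq_mul_add {k : ℕ} {y : ATilde} (hy : y.coeff 0 = X ^ k) (z : ATilde) :
    ∃ q r : ATilde, z = q * y + r ∧ DegLT k r := by
  let q : ATilde := ⟨quotCoeff k y.coeff z.coeff⟩
  refine ⟨q, z - q * y, by abel, fun N => ?_⟩
  -- Each coefficient of the remainder is a Euclidean remainder modulo `X ^ k`, as `q.coeff N` is
  -- the matching Euclidean quotient.
  have key : (z - q * y).coeff N =
      (z.coeff N - mc (fun m => if m < N then q.coeff m else 0) y.coeff N) %ₘ X ^ k := by
    rw [coeff_sub, coeff_mul, mc_eq_mul_add, hy, modByMonic_eq_sub_mul_div]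
    have : q.coeff N =
        (z.coeff N - mc (fun m => if m < N then q.coeff m else 0) y.coeff N) /ₘ X ^ k := by
      change quotCoeff k y.coeff z.coeff N = _
      rw [quotCoeff]
      simp only [dite_eq_ite, q]
    rw [← this]
    ring
  rw [key]
  simpa using degree_modByMonic_lt (z.coeff N - mc _ y.coeff N) (monic_X_pow (R := ℂ) k)

theorem ofPowerSeries_X : ofPowerSeries PowerSeries.X = b := by
  refine ext_coeff fun N => ?_
  by_cases h : N = 1 <;> simp [ofPowerSeries, b, coeff_single, PowerSeries.coeff_X, h]

theorem ofPowerSeries_C (c : ℂ) : ofPowerSeries (PowerSeries.C c) = single 0 (C c) := by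
  refine ext_coeff fun N => ?_
  by_cases h : N = 0 <;> simp [ofPowerSeries, coeff_single, PowerSeries.coeff_C, h]

/-- The coefficient of `a ^ j` when the powers of `b` are written on the left. -/
noncomputable def leftCoeff (x : ATilde) (j : ℕ) : PowerSeries ℂ :=
  PowerSeries.mk fun n => ((divB^[n] x).coeff 0).coeff j

theorem leftCoeff_eq (x : ATilde) (j : ℕ) : leftCoeff x j =
    PowerSeries.C ((x.coeff 0).coeff j) + PowerSeries.X * leftCoeff (divB x) j := by
  ext n
  rcases n with _ | n
  · simp [leftCoeff]
  · rw [map_add, PowerSeries.coeff_succ_X_mul]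
    simp [leftCoeff]

theorem coeff_b_mul_eq_zero {n : ℕ} {w : ATilde} (h : ∀ N < n, w.coeff N = 0) :
    ∀ N < n + 1, (b * w).coeff N = 0 := by
  intro N
  induction N with
  | zero => intro _; exact coeff_b_mul_zero w
  | succ N ih =>
    intro hN
    rw [coeff_b_mul_succ, h N (by omega), ih (by omega)]
    simp

/-- The defect of `r` equals `b` times the defect of `divB r`, which again has degree less than `k`
in `a`. Iterating, the defect vanishes to every order in `b`. -/
theorem eq_sum_leftCoeff {k : ℕ} {r : ATilde} (hr : DegLT k r) :
    r = ∑ j ∈ range k, ofPowerSeries (leftCoeff r j) * a ^ j := by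
  have key : ∀ n (r : ATilde), DegLT k r → ∀ N < n,
      (r - ∑ j ∈ range k, ofPowerSeries (leftCoeff r j) * a ^ j).coeff N = 0 := by
    intro n
    induction n with
    | zero => intro _ _ N hN; omega
    | succ n ih =>
      intro r hr
      have h1 : ∑ j ∈ range k, ofPowerSeries (leftCoeff r j) * a ^ j = single 0 (r.coeff 0) +
          b * ∑ j ∈ range k, ofPowerSeries (leftCoeff (divB r) j) * a ^ j := by
        have h2 : single 0 (r.coeff 0) =
            ∑ j ∈ range k, ofPowerSeries (PowerSeries.C ((r.coeff 0).coeff j)) * a ^ j := by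
          refine ext_coeff fun N => ?_
          simp only [ofPowerSeries_C, a_pow_eq, single_zero_mul_single, coeff_sum, coeff_single]
          split_ifs
          · ext i
            simp only [finsetSum_coeff, coeff_C_mul_X_pow, Finset.sum_ite_eq, mem_range]
            split_ifs with h
            · rfl
            · exact coeff_eq_zero_of_degree_lt ((hr 0).trans_le (by exact_mod_cast not_lt.1 h))
          · simp
        rw [h2, mul_sum, ← sum_add_distrib]
        refine sum_congr rfl fun j _ => ?_
        rw [leftCoeff_eq r j, map_add, map_mul, ofPowerSeries_X, add_mul, mul_assoc]
      have h3 : r - ∑ j ∈ range k, ofPowerSeries (leftCoeff r j) * a ^ j =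
          b * (divB r - ∑ j ∈ range k, ofPowerSeries (leftCoeff (divB r) j) * a ^ j) := by
        rw [h1]
        nth_rewrite 1 [← single_add_b_mul_divB r]
        rw [mul_sub]
        abel
      rw [h3]
      exact coeff_b_mul_eq_zero (ih _ hr.divB)
  refine sub_eq_zero.1 (ext_coeff fun N => ?_)
  exact key (N + 1) r hr N (Nat.lt_succ_self N)

/-! ### Homogeneous components and initial forms. -/

theorem coeff_coeff_sum_smul (k : ℕ) (l : ℕ → ℂ) (i ν : ℕ) :
    ((∑ j ∈ range (k + 1), l j • (a ^ j * b ^ (k - j))).coeff ν).coeff i =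
      if i + ν = k then l i else 0 := by
  simp only [coeff_sum, a_pow_mul_b_pow, coeff_smul, coeff_single, finsetSum_coeff,
    Polynomial.coeff_smul, smul_eq_mul]
  split_ifs with h
  · rw [sum_eq_single i]
    · simp [show ν = k - i by omega]
    · intro j _ hj
      split_ifs <;> simp [coeff_X_pow, hj.symm]
    · intro hi
      exact absurd (mem_range.2 (by omega)) hi
  · refine sum_eq_zero fun j hj => ?_
    rw [mem_range] at hj
    split_ifs with h1
    · rw [coeff_X_pow, if_neg (by omega), mul_zero]
    · simp

theorem coeff_coeff_homPart (n : ℕ) (x : ATilde) (i ν : ℕ) :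
    ((homPart n x).coeff ν).coeff i = if i + ν = n then (x.coeff ν).coeff i else 0 := by
  rw [homPart, coeff_coeff_sum_smul n fun j => (x.coeff (n - j)).coeff j]
  split_ifs with h
  · rw [show n - i = ν by omega]
  · rfl

theorem ext_coeff_coeff {x y : ATilde}
    (h : ∀ j ν, (x.coeff ν).coeff j = (y.coeff ν).coeff j) : x = y :=
  ext_coeff fun ν => Polynomial.ext fun j => h j ν

theorem coeff_coeff_of_isHomogeneousMonic {k : ℕ} {P : ATilde} (h : IsHomogeneousMonic k P) :
    (P.coeff 0).coeff k = 1 ∧ ∀ j ν, j + ν ≠ k → (P.coeff ν).coeff j = 0 := by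
  obtain ⟨l, hl, rfl⟩ := h
  simp only [coeff_coeff_sum_smul]
  exact ⟨by simpa using hl, fun j ν h => if_neg h⟩

theorem IsHomogeneousMonic.coeff_zero {k : ℕ} {P : ATilde} (h : IsHomogeneousMonic k P) :
    P.coeff 0 = X ^ k := by
  obtain ⟨h1, h2⟩ := coeff_coeff_of_isHomogeneousMonic h
  ext j
  rw [coeff_X_pow]
  split_ifs with hj
  · rw [hj, h1]
  · exact h2 j 0 hj

theorem IsHomogeneousMonic.valGE {k : ℕ} {P : ATilde} (h : IsHomogeneousMonic k P) :
    ValGE k P := fun j ν hj => (coeff_coeff_of_isHomogeneousMonic h).2 j ν hj.ne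

theorem IsHomogeneousMonic.eq_of_valGE {k : ℕ} {P Q : ATilde} (hP : IsHomogeneousMonic k P)
    (hQ : IsHomogeneousMonic k Q) (h : ValGE (k + 1) (P - Q)) : P = Q := by
  refine ext_coeff_coeff fun j ν => ?_
  by_cases hj : j + ν = k
  · have := h j ν (by omega)
    rwa [coeff_sub, Polynomial.coeff_sub, sub_eq_zero] at this
  · rw [(coeff_coeff_of_isHomogeneousMonic hP).2 j ν hj,
      (coeff_coeff_of_isHomogeneousMonic hQ).2 j ν hj]

/-- An element whose initial form is monic in `a` of degree `k` has valuation `k`. -/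
theorem valGE_of_initialForm {k : ℕ} {x : ATilde} (h : IsHomogeneousMonic k x.initialForm) :
    ValGE k x ∧ ValGE (k + 1) (x - x.initialForm) ∧ (x.coeff 0).coeff k = 1 := by
  obtain ⟨h1, -⟩ := coeff_coeff_of_isHomogeneousMonic h
  rw [initialForm, coeff_coeff_homPart] at h1
  -- The coefficient `1` of `a ^ k` can occur in the component of degree `valuation x` only if that
  -- degree is `k`; otherwise `h1` reads `0 = 1`.
  split_ifs at h1 with hk
  · rw [add_zero] at hk
    have hV : ValGE k x := by
      intro j ν hj
      have h2 : homPart (j + ν) x = 0 := by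
        by_contra h0
        exact Nat.notMem_of_lt_sInf (hj.trans_eq hk) h0
      have h3 := coeff_coeff_homPart (j + ν) x j ν
      rw [h2, if_pos rfl] at h3
      exact h3.symm.trans (by simp [ATilde.coeff_zero])
    refine ⟨hV, fun j ν hj => ?_, h1⟩
    rw [coeff_sub, Polynomial.coeff_sub, initialForm, ← hk, coeff_coeff_homPart]
    split_ifs with hjk
    · exact sub_self _
    · rw [hV j ν (by omega), sub_zero]
  · simp at h1

theorem valGE_one_sub_single {u : ATilde} {c : ℂ} (h : (u.coeff 0).coeff 0 = c) :
    ValGE 1 (u - c • 1) := by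
  intro j ν hj
  obtain ⟨rfl, rfl⟩ : j = 0 ∧ ν = 0 := by omega
  simp [coeff_sub, coeff_smul, one_def, coeff_single, h]

end ATilde

open ATilde

section Modules

/-! ### The annihilator of a generator. -/

variable {F : Type*} [AddCommGroup F] [Module ATilde F]

theorem exists_degLT_smul_eq {k : ℕ} {e : F} (he : ∀ f : F, ∃ z : ATilde, f = z • e)
    {y : ATilde} (hy0 : y.coeff 0 = X ^ k) (hye : y • e = 0) (f : F) :
    ∃ r : ATilde, DegLT k r ∧ f = r • e := by
  obtain ⟨z, rfl⟩ := he f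
  obtain ⟨q, r, rfl, hr⟩ := exists_eq_mul_add hy0 z
  exact ⟨r, hr, by rw [add_smul, mul_smul, hye, smul_zero, zero_add]⟩

/-- A monogenic (a,b)-module of rank at least `k` whose generator is killed by an element that is
`a ^ k` modulo `b` has rank `k`, and its generator is killed by no polynomial in `a` of degree less
than `k`. -/
theorem rank_eq_of_smul_eq_zero (hF : IsABModule F) {k : ℕ} {e : F}
    (he : ∀ f : F, ∃ z : ATilde, f = z • e) (hk : k ≤ rank F) {y : ATilde}
    (hy0 : y.coeff 0 = X ^ k) (hye : y • e = 0) :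
    rank F = k ∧ ∀ r : ATilde, DegLT k r → r • e = 0 → r = 0 := by
  let := powerSeriesModule F
  obtain ⟨hfree, hfin⟩ := hF
  let ψ : (Fin k → PowerSeries ℂ) →ₗ[PowerSeries ℂ] F :=
    Fintype.linearCombination (PowerSeries ℂ) fun j : Fin k => a ^ (j : ℕ) • e
  have hψ : ∀ r : ATilde, DegLT k r → ψ (fun j => leftCoeff r j) = r • e := by
    intro r hr
    conv_rhs => rw [eq_sum_leftCoeff hr, sum_smul, Finset.sum_range]
    rw [Fintype.linearCombination_apply]
    refine sum_congr rfl fun j _ => ?_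
    rw [mul_smul]
    rfl
  have hsurj : Function.Surjective ψ := by
    intro f
    obtain ⟨r, hr, rfl⟩ := exists_degLT_smul_eq he hy0 hye f
    exact ⟨_, hψ r hr⟩
  have hrank : Module.finrank (PowerSeries ℂ) F = k := by
    refine le_antisymm ?_ hk
    simpa using LinearMap.finrank_le_finrank_of_surjective hsurj
  refine ⟨hrank, fun r hr hre => ?_⟩
  -- Any identification of `F` with `ℂ[[b]] ^ k` turns `ψ` into a surjective endomorphism of a
  -- finite module, hence an injective one.
  have φ : F ≃ₗ[PowerSeries ℂ] (Fin k → PowerSeries ℂ) :=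
    LinearEquiv.ofFinrankEq _ _ (by rw [hrank]; simp)
  have hinj : Function.Injective (φ.toLinearMap ∘ₗ ψ) :=
    OrzechProperty.injective_of_surjective_endomorphism _ (φ.surjective.comp hsurj)
  have h0 : (fun j : Fin k => leftCoeff r j) = 0 := by
    apply hinj
    simp [hψ r hr, hre]
  rw [eq_sum_leftCoeff hr, Finset.sum_range]
  refine sum_eq_zero fun j _ => ?_
  rw [show leftCoeff r j = 0 from congrFun h0 j, map_zero, zero_mul]

theorem exists_eq_mul_of_smul_eq_zero {k : ℕ} {e : F} {y : ATilde}
    (hy0 : y.coeff 0 = X ^ k) (hye : y • e = 0)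
    (hinj : ∀ r : ATilde, DegLT k r → r • e = 0 → r = 0) {z : ATilde} (hz : z • e = 0) :
    ∃ q, z = q * y := by
  obtain ⟨q, r, rfl, hr⟩ := exists_eq_mul_add hy0 z
  rw [add_smul, mul_smul, hye, smul_zero, zero_add] at hz
  exact ⟨q, by rw [hinj r hr hz, add_zero]⟩

/-- Write the coefficient of `b ^ 0` in `x` as `X ^ k * u` with `u(0) = 1`. The factor `u` is
invertible modulo `X ^ N`, and multiples of `a ^ N` act on `e` as elements of `b * Ã`, so the
correction does not affect that coefficient beyond the Bézout relation. -/
theorem exists_coeff_zero_eq_X_pow {k N : ℕ} {e : F} (he : ∀ f : F, ∃ z : ATilde, f = z • e)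
    (hN : ∀ f : F, ∃ g : F, a ^ N • f = b • g) {x : ATilde} (hxe : x • e = 0)
    (hx : ValGE k x) (hxk : (x.coeff 0).coeff k = 1) :
    ∃ y : ATilde, y.coeff 0 = X ^ k ∧ y • e = 0 := by
  obtain ⟨u, hu⟩ : X ^ k ∣ x.coeff 0 :=
    X_pow_dvd_iff.2 fun d hd => hx d 0 (by simpa using hd)
  have hu0 : u.coeff 0 = 1 := by
    rw [hu, coeff_X_pow_mul'] at hxk
    simpa using hxk
  have hcop : IsCoprime u (X ^ N) := by
    refine IsCoprime.pow_right ⟨1, -divX u, ?_⟩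
    have := X_mul_divX_add u
    rw [hu0, C_1] at this
    linear_combination -this
  obtain ⟨v, w, hvw⟩ := hcop
  obtain ⟨g, hg⟩ := hN (single 0 (X ^ k * w) • e)
  obtain ⟨z, rfl⟩ := he g
  refine ⟨single 0 v * x + (a ^ N * single 0 (X ^ k * w) - b * z), ?_, ?_⟩
  · rw [coeff_add, coeff_sub, coeff_mul_zero, coeff_b_mul_zero, a_pow_eq,
      single_zero_mul_single, hu]
    simp only [coeff_single, if_true]
    linear_combination X ^ k * hvw
  · rw [add_smul, sub_smul, mul_smul, mul_smul, mul_smul, hxe, hg]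
    simp

/-- The generator of the annihilator. -/
theorem exists_annihilator_generator {k N : ℕ} (hF : IsABModule F) {e : F}
    (he : ∀ f : F, ∃ z : ATilde, f = z • e) (hN : ∀ f : F, ∃ g : F, a ^ N • f = b • g)
    (hk : k ≤ rank F) {x : ATilde} (hxe : x • e = 0)
    (hin : IsHomogeneousMonic k x.initialForm) :
    rank F = k ∧ ∃ y : ATilde, y.coeff 0 = X ^ k ∧ y • e = 0 ∧
      (∀ z : ATilde, z • e = 0 → ∃ q, z = q * y) ∧ DegLT k (y - x.initialForm) ∧
      ValGE (k + 1) (y - x.initialForm) := by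
  obtain ⟨hxV, hxP, hxk⟩ := valGE_of_initialForm hin
  obtain ⟨y', hy0', hye'⟩ := exists_coeff_zero_eq_X_pow he hN hxe hxV hxk
  obtain ⟨hrank, hinj⟩ := rank_eq_of_smul_eq_zero hF he hk hy0' hye'
  refine ⟨hrank, ?_⟩
  -- Normalisation: `a ^ k - r` also kills `e`, and apart from `a ^ k` it involves only powers of
  -- `a` below `k`.
  obtain ⟨q, r, hqr, hr⟩ := exists_eq_mul_add hy0' (single 0 (X ^ k))
  have hy0 : (single 0 (X ^ k) - r).coeff 0 = X ^ k := by
    have h1 : (single 0 (X ^ k) - r).coeff 0 = q.coeff 0 * X ^ k := by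
      rw [hqr, add_sub_cancel_right, coeff_mul_zero, hy0']
    have h2 : r.coeff 0 = 0 := by
      refine eq_zero_of_dvd_of_degree_lt (p := X ^ k) ⟨1 - q.coeff 0, ?_⟩ ?_
      · rw [coeff_sub] at h1
        simp only [coeff_single, if_true] at h1
        linear_combination -h1
      · simpa using hr 0
    rw [coeff_sub, h2, sub_zero, coeff_single, if_pos rfl]
  have hye : (single 0 (X ^ k) - r) • e = 0 := by
    rw [hqr, add_sub_cancel_right, mul_smul, hye', smul_zero]
  have hdeg : ∀ j ν, k ≤ j → j + ν ≠ k → ((single 0 (X ^ k) - r).coeff ν).coeff j = 0 := by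
    intro j ν hj hjν
    rw [coeff_sub, Polynomial.coeff_sub, coeff_eq_zero_of_degree_lt
      ((hr ν).trans_le (by exact_mod_cast hj)), sub_zero, coeff_single]
    split_ifs with h
    · rw [coeff_X_pow, if_neg (by omega)]
    · rfl
  generalize single 0 (X ^ k) - r = y at hy0 hye hdeg
  have hann := fun z hz => exists_eq_mul_of_smul_eq_zero (z := z) hy0 hye hinj hz
  refine ⟨y, hy0, hye, hann, ?_⟩
  obtain ⟨p, hp⟩ := hann x hxe
  have hp1 : ValGE 1 (p - (1 : ℂ) • 1) := by
    refine valGE_one_sub_single ?_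
    have := hxk
    rw [hp, coeff_mul_zero, hy0, coeff_mul_X_pow'] at this
    simpa using this
  have hsub : x - y = (p - (1 : ℂ) • 1) * y := by rw [sub_mul, ← hp]; simp
  -- Bootstrap: `x - y = (p - 1) * y` has valuation one more than the bound known for `y`, and `x`
  -- has valuation at least `k`, so the bound for `y` climbs up to `k`.
  have hyV : ∀ m ≤ k, ValGE m y := by
    intro m
    induction m with
    | zero => exact fun _ => valGE_zero y
    | succ m ih =>
      intro hm
      have h1 : ValGE (m + 1) (x - y) := by
        rw [hsub, add_comm]
        exact hp1.mul (ih (by omega))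
      simpa using (hxV.mono hm).sub h1
  have hV : ValGE (k + 1) (y - x.initialForm) := by
    have h1 : ValGE (k + 1) (x - y) := by
      rw [hsub, add_comm]
      exact hp1.mul (hyV k le_rfl)
    simpa using hxP.sub h1
  refine ⟨fun ν => (degree_lt_iff_coeff_zero _ _).2 fun j hj => ?_, hV⟩
  by_cases h : j + ν < k + 1
  · exact hV j ν h
  · rw [coeff_sub, Polynomial.coeff_sub, hdeg j ν hj (by omega),
      (coeff_coeff_of_isHomogeneousMonic hin).2 j ν (by omega), sub_zero]

/-! ### Existence and uniqueness of the Bernstein element. -/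

/-- A monomial `a ^ j * b ^ ν` with `j ≤ k - 1` and `j + ν ≥ k + 1` has `ν ≥ 2`. -/
theorem exists_eq_b_sq_mul {k : ℕ} {z : ATilde} (hz : DegLT k z) (hV : ValGE (k + 1) z) :
    ∃ R : ATilde, z = b ^ 2 * R ∧ DegLT k R ∧ ∀ m, m + 1 < k → homPart m R = 0 := by
  have h : ∀ ν < 2, z.coeff ν = 0 := by
    intro ν hν
    ext j
    by_cases hj : j < k
    · exact hV j ν (by omega)
    · exact coeff_eq_zero_of_degree_lt ((hz ν).trans_le (by exact_mod_cast not_lt.1 hj))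
  refine ⟨divB (divB z), ?_, hz.divB.divB, fun m hm => ?_⟩
  · have h1 : (divB z).coeff 0 = 0 := by simp [divB, h 1]
    rw [pow_two, mul_assoc, b_mul_divB h1, b_mul_divB (h 0 (by omega))]
  · obtain ⟨k, rfl⟩ : ∃ n, k = n + 1 := ⟨k - 1, by omega⟩
    refine ext_coeff_coeff fun j ν => ?_
    rw [coeff_coeff_homPart]
    split_ifs with hj
    · rw [hV.divB.divB j ν (by omega)]; simp [ATilde.coeff_zero]
    · simp [ATilde.coeff_zero]

theorem nonempty_equiv_quotient {e : F} (he : ∀ f : F, ∃ z : ATilde, f = z • e)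
    {I : Ideal ATilde} (hI : ∀ z : ATilde, z • e = 0 ↔ z ∈ I) :
    Nonempty (F ≃ₗ[ATilde] ATilde ⧸ I) := by
  have hker : LinearMap.ker (LinearMap.toSpanSingleton ATilde F e) = I := by
    ext z
    simp [hI]
  subst hker
  refine ⟨(LinearMap.quotKerEquivOfSurjective _ fun f => ?_).symm⟩
  obtain ⟨z, rfl⟩ := he f
  exact ⟨z, rfl⟩

theorem exists_generator_of_equiv {I : Ideal ATilde} (φ : F ≃ₗ[ATilde] ATilde ⧸ I) :
    ∃ e : F, (∀ f : F, ∃ z : ATilde, f = z • e) ∧ ∀ z : ATilde, z • e = 0 ↔ z ∈ I := by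
  refine ⟨φ.symm (Submodule.Quotient.mk 1), fun f => ?_, fun z => ?_⟩
  · obtain ⟨z, hz⟩ := Submodule.Quotient.mk_surjective I (φ f)
    refine ⟨z, φ.injective ?_⟩
    rw [map_smul, LinearEquiv.apply_symm_apply, ← hz, ← Submodule.Quotient.mk_smul, smul_eq_mul,
      mul_one]
  · rw [← map_smul, LinearEquiv.map_eq_zero_iff, ← Submodule.Quotient.mk_smul, smul_eq_mul,
      mul_one, Submodule.Quotient.mk_eq_zero]

theorem valGE_b_sq_mul {k : ℕ} {R : ATilde} (h : ∀ m, m + 1 < k → homPart m R = 0) :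
    ValGE (k + 1) (b ^ 2 * R) := by
  -- For `k = 0` the truncated bound is empty, and the factor `b ^ 2` alone suffices.
  have hR : ValGE (k - 1) R := by
    intro j ν hj
    have h3 := coeff_coeff_homPart (j + ν) R j ν
    rw [h _ (by omega), if_pos rfl] at h3
    exact h3.symm.trans (by simp [ATilde.coeff_zero])
  rw [pow_two]
  exact ((valGE_b.mul valGE_b).mul hR).mono (by omega)

/-- The initial form of a generator of the annihilator does not depend on the generator of the
module. -/
theorem initialForm_annihilator_unique {k : ℕ} {e e' : F}
    (he : ∀ f : F, ∃ z : ATilde, f = z • e) (he' : ∀ f : F, ∃ z : ATilde, f = z • e')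
    {y y' P P' : ATilde} (hy0 : y.coeff 0 = X ^ k)
    (hann : ∀ z : ATilde, z • e = 0 → ∃ q, z = q * y) (hy0' : y'.coeff 0 = X ^ k)
    (hye' : y' • e' = 0) (hP : IsHomogeneousMonic k P) (hP' : IsHomogeneousMonic k P')
    (hyP : ValGE (k + 1) (y - P)) (hyP' : ValGE (k + 1) (y' - P')) : P' = P := by
  rcases Nat.eq_zero_or_pos k with rfl | hk
  · obtain ⟨l, hl, rfl⟩ := hP
    obtain ⟨l', hl', rfl⟩ := hP'
    simp [hl, hl']
  obtain ⟨u, hu⟩ := he e'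
  obtain ⟨v, hv⟩ := he' e
  -- If `u` had no constant term, `1 - v * u` would have constant term `1`, yet it kills `e` and so
  -- is a multiple of `y`, whose constant term is `0` as `k > 0`.
  have hc : (u.coeff 0).coeff 0 ≠ 0 := by
    intro h0
    obtain ⟨q, hq⟩ := hann (1 - v * u) (by rw [sub_smul, mul_smul, ← hu, ← hv, one_smul, sub_self])
    have := congrArg (fun z : ATilde => (z.coeff 0).coeff 0) hq
    simp [coeff_sub, coeff_mul_zero, hy0, one_def, coeff_single, h0, coeff_X_pow, hk.ne,
      mul_coeff_zero] at this
  obtain ⟨w, hw⟩ := hann (y' * u) (by rw [mul_smul, ← hu, hye'])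
  have hwu : w.coeff 0 = u.coeff 0 := by
    have := congrArg (fun z : ATilde => z.coeff 0) hw
    simp only [coeff_mul_zero, hy0, hy0', mul_comm (X ^ k : ℂ[X])] at this
    exact mul_right_cancel₀ (pow_ne_zero k X_ne_zero) this.symm
  generalize hcu : (u.coeff 0).coeff 0 = c at hc
  have h1 := (hP'.valGE).mul (valGE_one_sub_single hcu)
  have h2 := (valGE_one_sub_single (u := w) (by rw [hwu, hcu])).mul hP.valGE
  have h3 := hyP'.mul (valGE_zero u)
  have h4 := (valGE_zero w).mul hyP
  rw [add_comm 1 k] at h2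
  rw [zero_add] at h4
  rw [add_zero] at h3
  -- In degree `k` the equality `y' * u = w * y` reads `c • P' = c • P`; every other contribution
  -- has valuation at least `k + 1`.
  have h5 : ValGE (k + 1) (c • (P' - P)) := by
    have h6 := ((h2.add h4).sub h1).sub h3
    have h7 : c • (P' - P) = (w - c • 1) * P + w * (y - P) - P' * (u - c • 1) - (y' - P') * u := by
      simp only [sub_mul, mul_sub, smul_mul_assoc, mul_smul_comm, one_mul, mul_one, smul_sub, hw]
      abel
    rwa [h7]
  refine hP'.eq_of_valGE hP fun j ν hj => ?_
  have := h5 j ν hj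
  rw [ATilde.coeff_smul, Polynomial.coeff_smul] at this
  exact (smul_eq_zero.1 this).resolve_left hc

/-- A presentation by `P + b ^ 2 * R` amounts to a generator of `F` with annihilator generated by
that element, whose part of degree `k` is `P`. The normalised generator `y` provides one such
presentation. -/
theorem isBernsteinElement_iff {k N : ℕ} (hF : IsABModule F) {e : F}
    (he : ∀ f : F, ∃ z : ATilde, f = z • e) (hN : ∀ f : F, ∃ g : F, a ^ N • f = b • g)
    (hk : k ≤ rank F) {x : ATilde} (hxe : x • e = 0)
    (hin : IsHomogeneousMonic k x.initialForm) (P : ATilde) :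
    IsBernsteinElement F P ↔ P = x.initialForm := by
  obtain ⟨hrank, y, hy0, hye, hann, hyd, hyV⟩ := exists_annihilator_generator hF he hN hk hxe hin
  rw [IsBernsteinElement, hrank]
  constructor
  · rintro ⟨hP, R, -, hR, ⟨φ⟩⟩
    obtain ⟨e', he', hI⟩ := exists_generator_of_equiv φ
    refine initialForm_annihilator_unique he he' hy0 hann (y' := P + b ^ 2 * R) ?_
      ((hI _).2 (Ideal.mem_span_singleton_self _)) hin hP hyV ?_
    · simp [coeff_add, hP.coeff_zero, pow_two, mul_assoc, coeff_b_mul_zero]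
    · simpa using valGE_b_sq_mul hR
  · rintro rfl
    obtain ⟨R, hR, hRd, hRV⟩ := exists_eq_b_sq_mul hyd hyV
    refine ⟨hin, R, hRd, hRV, nonempty_equiv_quotient he fun z => ?_⟩
    rw [← hR, add_sub_cancel, Ideal.mem_span_singleton']
    constructor
    · intro hz
      obtain ⟨q, rfl⟩ := hann z hz
      exact ⟨q, rfl⟩
    · rintro ⟨q, rfl⟩
      rw [mul_smul, hye, smul_zero]

end Modules

/-! ### Regular modules: submodules, and nilpotency of `a` modulo `b`. -/

section Regular

universe u

/-- `ℂ[[b]]` is a principal ideal domain, so a submodule of a finite free module is finite and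
torsion-free, hence free. -/
theorem IsABModule.of_injective {F G : Type*} [AddCommGroup F] [Module ATilde F] [AddCommGroup G]
    [Module ATilde G] (hG : IsABModule G) (φ : F →ₗ[ATilde] G) (hφ : Function.Injective φ) :
    IsABModule F := by
  let := powerSeriesModule F
  let := powerSeriesModule G
  obtain ⟨hfree, hfin⟩ := hG
  let ψ : F →ₗ[PowerSeries ℂ] G :=
    { toFun := φ, map_add' := map_add φ, map_smul' := fun S f => map_smul φ (ofPowerSeries S) f }
  have hF : Module.Finite (PowerSeries ℂ) F := Module.Finite.of_injective ψ hφ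
  have : Module.IsTorsionFree (PowerSeries ℂ) F := hφ.moduleIsTorsionFree ψ fun S f => map_smul ψ S f
  exact ⟨Module.free_of_finite_type_torsion_free', hF⟩

theorem IsRegular.of_injective {F E : Type u} [AddCommGroup F] [Module ATilde F] [AddCommGroup E]
    [Module ATilde E] (hE : IsRegular E) (φ : F →ₗ[ATilde] E) (hφ : Function.Injective φ) :
    IsRegular F := by
  obtain ⟨hE, G, _, _, hG, ψ, hψ⟩ := hE
  exact ⟨hE.of_injective φ hφ, G, _, _, hG, ψ ∘ₗ φ, hψ.comp hφ⟩

/-- With a simple pole, `a + n • b` still maps into the image of `b`; so each further `a` yields one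
more factor `b` to the left of `b`-powers already extracted. -/
theorem a_mul_b_pow (n : ℕ) : a * b ^ n = b ^ n * (a + n • b) := by
  induction n with
  | zero => simp
  | succ n ih =>
    have h : a * b = b * (a + b) := by
      rw [mul_add, ← pow_two, ← a_mul_b_sub_b_mul_a]
      abel
    rw [pow_succ, ← mul_assoc, ih, mul_assoc, add_mul, h, mul_assoc, succ_nsmul, smul_mul_assoc,
      ← mul_smul_comm, ← mul_add]
    congr 2
    abel

theorem IsSimplePole.exists_a_pow_smul {G : Type*} [AddCommGroup G] [Module ATilde G]
    (hG : IsSimplePole G) (n : ℕ) (f : G) : ∃ g : G, a ^ n • f = b ^ n • g := by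
  induction n with
  | zero => exact ⟨f, by simp⟩
  | succ n ih =>
    obtain ⟨g, hg⟩ := ih
    obtain ⟨g', hg'⟩ := hG.2 g
    refine ⟨g' + n • g, ?_⟩
    rw [pow_succ', mul_smul, hg, ← mul_smul, a_mul_b_pow, mul_smul, add_smul, hg', pow_succ,
      mul_smul, smul_assoc, smul_comm n b g, ← smul_add]

/-- On a regular (a,b)-module, `a` acts nilpotently modulo `b`. -/
theorem IsRegular.exists_a_pow_smul {F : Type u} [AddCommGroup F] [Module ATilde F]
    (hF : IsRegular F) : ∃ N, ∀ f : F, ∃ g : F, a ^ N • f = b • g := by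
  obtain ⟨-, G, _, _, hG, φ, hφ⟩ := hF
  let := powerSeriesModule F
  let := powerSeriesModule G
  obtain ⟨hfree, hfin⟩ := hG.1
  let ψ : F →ₗ[PowerSeries ℂ] G :=
    { toFun := φ, map_add' := map_add φ, map_smul' := fun S f => map_smul φ (ofPowerSeries S) f }
  -- Artin–Rees: elements of `F` lying in `b ^ (k + 1) G` lie in `bF`, and `a ^ (k + 1)` sends `F`
  -- into `b ^ (k + 1) G`.
  obtain ⟨k, hk⟩ := Ideal.exists_pow_inf_eq_pow_smul
    (Ideal.span {(PowerSeries.X : PowerSeries ℂ)}) (LinearMap.range ψ)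
  refine ⟨k + 1, fun f => ?_⟩
  obtain ⟨g, hg⟩ := hG.exists_a_pow_smul (k + 1) (φ f)
  have h1 : φ (a ^ (k + 1) • f) ∈ Ideal.span {(PowerSeries.X : PowerSeries ℂ)} ^ (k + 1) •
      (⊤ : Submodule (PowerSeries ℂ) G) ⊓ LinearMap.range ψ := by
    refine ⟨?_, ⟨_, rfl⟩⟩
    rw [map_smul, hg, Ideal.span_singleton_pow, ← ofPowerSeries_X, ← map_pow]
    exact Submodule.smul_mem_smul (Ideal.mem_span_singleton_self _) Submodule.mem_top
  rw [hk (k + 1) (by omega), Nat.add_sub_cancel_left, pow_one,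
    Submodule.ideal_span_singleton_smul, Submodule.mem_smul_pointwise_iff_exists] at h1
  obtain ⟨_, ⟨-, h, rfl⟩, h2⟩ := h1
  refine ⟨h, hφ ?_⟩
  rw [← h2, map_smul, ← ofPowerSeries_X]
  rfl

end Regular

end AB

theorem mainTheorem3 {E : Type*} [AddCommGroup E] [Module AB.ATilde E] (hE : AB.IsRegular E)
    (e : E) (k : ℕ) (x : AB.ATilde) (hx : x • e = 0)
    (hin : AB.ATilde.IsHomogeneousMonic k x.initialForm)
    (hrank : k ≤ AB.rank (Submodule.span AB.ATilde {e})) :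
    AB.IsRegular (Submodule.span AB.ATilde {e}) ∧
    AB.IsMonogenic (Submodule.span AB.ATilde {e}) ∧
    AB.rank (Submodule.span AB.ATilde {e}) = k ∧
    ∀ P : AB.ATilde,
      AB.IsBernsteinElement (Submodule.span AB.ATilde {e}) P ↔ P = x.initialForm := by
  have hF : AB.IsRegular (Submodule.span AB.ATilde {e}) :=
    hE.of_injective (Submodule.subtype _) (Submodule.subtype_injective _)
  let e' : Submodule.span AB.ATilde {e} := ⟨e, Submodule.mem_span_singleton_self e⟩
  have he : ∀ f : Submodule.span AB.ATilde {e}, ∃ z : AB.ATilde, f = z • e' := by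
    rintro ⟨f, hf⟩
    obtain ⟨z, rfl⟩ := Submodule.mem_span_singleton.1 hf
    exact ⟨z, rfl⟩
  have hxe : x • e' = 0 := Subtype.ext hx
  obtain ⟨N, hN⟩ := hF.exists_a_pow_smul
  have hB := AB.isBernsteinElement_iff hF.1 he hN hrank hxe hin
  -- The presentation attached to the Bernstein element already shows that `F` is monogenic.
  obtain ⟨-, R, -, -, hR⟩ := (hB _).2 rfl
  exact ⟨hF, ⟨_, hR⟩, (AB.exists_annihilator_generator hF.1 he hN hrank hxe hin).1, hB⟩
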